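/- Let $\mathbb{K}$ be a commutative ring containing $\mathbb{Q}$ (i.e. a commutative $\mathbb{Q}$-algebra; for instance, a field of characteristic $0$) and let $n\ge 0$ be an integer. Let $\operatorname{U}(n)=\mathbb{K}[\tilde h_1,\dots,\tilde h_n]$, put $\tilde h_{ij}=\tilde h_i-\tilde h_j$, and let $\bar{\operatorname{U}}(n)$ be the ring of fractions of $\operatorname{U}(n)$ with respect to the multiplicative set generated by the elements $\tilde h_{ij}+a$, where $a\in\mathbb{Z}$ and $i\ne j$. For $j=1,\dots,n$ let $f\mapsto f[-\varepsilon_j]$ be the automorphism of $\bar{\operatorname{U}}(n)$ over $\mathbb{K}$ with $\tilde h_i\mapsto \tilde h_i-\delta_{ij}$, and let $\Delta_j f=f-f[-\varepsilon_j]$. Let $\chi_j=\prod_{k\ne j}\tilde h_{jk}$, let $\mathcal{W}_j\subset\bar{\operatorname{U}}(n)$ be the $\mathbb{K}$-submodule of all elements $\pi(\tilde h_j)/\chi_j$ with $\pi$ a univariate polynomial over $\mathbb{K}$, and let $\mathcal{W}=\sum_{j=1}^n\mathcal{W}_j$. Then elements $\sigma_1,\dots,\sigma_n\in\bar{\operatorname{U}}(n)$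 satisfy the system $$\tilde h_{ij}\,\Delta_j\sigma_i=\sigma_i-\sigma_j,\qquad i,j=1,\dots,n,$$ if and only if there is an element $\sigma\in\mathcal{W}$ such that $\sigma_i=\Delta_i\sigma$ for all $i=1,\dots,n$. In particular, every solution $\sigma_1,\dots,\sigma_n$ of the system has a potential $\sigma\in\bar{\operatorname{U}}(n)$, $\sigma_i=\Delta_i\sigma$. -/

import Mathlib

namespace HDeformed

noncomputable section

variable (K : Type*) [CommRing K] (n : ℕ)

/-- The ring `U(n)`: the enveloping algebra of the abelian Lie algebra with generators
`h̃_1, …, h̃_n`, that is, the polynomial ring in these variables. -/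
abbrev U : Type _ := MvPolynomial (Fin n) K

/-- The multiplicative set generated by the elements `h̃_i - h̃_j + a`, `a ∈ ℤ`, `i ≠ j`. -/
def denominators : Submonoid (U K n) :=
  Submonoid.closure
    {p | ∃ i j : Fin n, i ≠ j ∧ ∃ a : ℤ, p = MvPolynomial.X i - MvPolynomial.X j + (a : U K n)}

/-- The ring of fractions `Ū(n)` of `U(n)`. -/
abbrev Ubar : Type _ := Localization (denominators K n)

variable {n}

/-- The element `h̃_{ij} = h̃_i - h̃_j` of `Ū(n)`. -/
def hdiff (i j : Fin n) : Ubar K n :=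
  algebraMap (U K n) (Ubar K n) (MvPolynomial.X i - MvPolynomial.X j)

/-- The translation `-ε_j` of `U(n)`: `h̃_i ↦ h̃_i - δ_{ij}`. -/
def polyShift (j : Fin n) : U K n →ₐ[K] U K n :=
  MvPolynomial.aeval fun i => MvPolynomial.X i - if i = j then 1 else 0

theorem denominators_le_comap (j : Fin n) :
    denominators K n ≤ (denominators K n).comap (polyShift K j : U K n →+* U K n) := by
  refine Submonoid.closure_le.2 ?_
  rintro _ ⟨k, l, hkl, a, rfl⟩
  refine Submonoid.subset_closure
    ⟨k, l, hkl, a - (if k = j then 1 else 0) + (if l = j then 1 else 0), ?_⟩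
  simp only [polyShift, RingHom.coe_coe, map_add, map_sub, MvPolynomial.aeval_X, map_intCast]
  split_ifs <;> push_cast <;> ring

/-- The extension `f ↦ f[-ε_j]` of the translation to `Ū(n)`. -/
def shift (j : Fin n) : Ubar K n →+* Ubar K n :=
  IsLocalization.map (Ubar K n) (polyShift K j : U K n →+* U K n) (denominators_le_comap K j)

/-- The finite-difference operator `Δ_j f = f - f[-ε_j]`. -/
def Delta (j : Fin n) (f : Ubar K n) : Ubar K n := f - shift K j f

/-- The polynomial `χ_j = ∏_{k ≠ j} (h̃_j - h̃_k)`. -/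
def chi (j : Fin n) : U K n :=
  ∏ k ∈ Finset.univ.erase j, (MvPolynomial.X j - MvPolynomial.X k)

theorem chi_mem (j : Fin n) : chi K j ∈ denominators K n := by
  refine Submonoid.prod_mem _ fun k hk => Submonoid.subset_closure ?_
  exact ⟨j, k, (Finset.ne_of_mem_erase hk).symm, 0, by simp⟩

/-- The space `𝒲_j` of the elements `π(h̃_j) / χ_j` of `Ū(n)`, where `π` is a univariate
polynomial. -/
def Wpart (j : Fin n) : Submodule K (Ubar K n) where
  carrier := {f | ∃ p : Polynomial K,
    f = Localization.mk (Polynomial.aeval (MvPolynomial.X j : U K n) p) ⟨chi K j, chi_mem K j⟩}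
  zero_mem' := ⟨0, by simp [Localization.mk_zero]⟩
  add_mem' := by
    rintro _ _ ⟨p, rfl⟩ ⟨q, rfl⟩
    exact ⟨p + q, by rw [map_add, Localization.add_mk_self]⟩
  smul_mem' := by
    rintro c _ ⟨p, rfl⟩
    exact ⟨c • p, by rw [map_smul, Localization.smul_mk]⟩

variable (n)

/-- The sum `𝒲` of the spaces `𝒲_1, …, 𝒲_n`. -/
def W : Submodule K (Ubar K n) := ⨆ j : Fin n, Wpart K j

end

end HDeformed

namespace HDeformed

noncomputable section

/-! The identity h̃_ij Δ_jΔ_i f − (Δ_i f − Δ_j f) = Δ_iΔ_j(h̃_ij f) turns the system for σ_i = Δ_i f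
into Δ_iΔ_j(h̃_ij f) = 0 for i ≠ j (`IsPotential`). Elements of 𝒲 satisfy this by partial fractions.

Conversely, adding the equations for (i, j) and (j, i) gives Δ_iσ_j = Δ_jσ_i, and each σ_i is a
Δ_i-difference, so a Poincaré lemma (`exists_potential`) yields f. That f ∈ 𝒲
(`IsPotential.exists_eq_sum`) follows by induction on the set of variables, expanding f in powers of
1/h̃_i. A term π(h̃_i)/∏(h̃_i − h̃_l) removes all nonnegative powers of h̃_i; the coefficient of
1/h̃_i is then a potential in fewer variables; once it is cancelled, the remainder is again of the
form π(h̃_i)/∏(h̃_i − h̃_l).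

Throughout, translation invariance must mean independence of a variable, although K may have zero
divisors. This is `algHom_eq_of_shift_fixed`, where ℚ → K is essential. -/

open Polynomial in
/-- A polynomial vanishing at all large natural numbers is zero, if the nonzero naturals are
invertible. -/
theorem eq_zero_of_eval_natCast {B : Type*} [CommRing B]
    (hB : ∀ m : ℕ, m ≠ 0 → IsUnit (m : B)) (P : B[X]) (N : ℕ)
    (h : ∀ m : ℕ, N ≤ m → P.eval (m : B) = 0) : P = 0 := by
  nontriviality B
  induction hd : P.natDegree using Nat.strong_induction_on generalizing P N with
  | _ d ih =>
    obtain ⟨Q, hQ⟩ := dvd_iff_isRoot.2 (h N le_rfl)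
    by_cases hQ0 : Q = 0
    · rw [hQ, hQ0, mul_zero]
    have hdeg : P.natDegree = 1 + Q.natDegree := by
      rw [hQ, (monic_X_sub_C _).natDegree_mul' hQ0, natDegree_X_sub_C]
    -- For m > N the factor m − N is a unit, so the quotient by X − N vanishes there; no domain
    -- hypothesis is needed.
    refine absurd (ih Q.natDegree (by omega) Q (N + 1) (fun m hm => ?_) rfl) hQ0
    have h1 := h m (by omega)
    rw [hQ, eval_mul, eval_sub, eval_X, eval_C, ← Nat.cast_sub (by omega)] at h1
    exact (hB (m - N) (by omega)).mul_right_eq_zero.1 h1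

/-! ### Universal property, translations and differences -/

variable {K : Type*} [CommRing K] {n : ℕ}

/-- The generator `h̃_k` of `Ū(n)`. -/
def hvar (K : Type*) [CommRing K] {n : ℕ} (k : Fin n) : Ubar K n :=
  algebraMap (U K n) (Ubar K n) (MvPolynomial.X k)

theorem hdiff_eq (i j : Fin n) : hdiff K i j = hvar K i - hvar K j := by
  simp [hdiff, hvar]

theorem isUnit_hvar_sub_add {k l : Fin n} (h : k ≠ l) (a : ℤ) :
    IsUnit (hvar K k - hvar K l + (a : Ubar K n)) := by
  have := IsLocalization.map_units (Ubar K n) (⟨_, Submonoid.subset_closure ⟨k, l, h, a, rfl⟩⟩ :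
    denominators K n)
  simpa [hvar] using this

theorem isUnit_hvar_sub {k l : Fin n} (h : k ≠ l) : IsUnit (hvar K k - hvar K l) := by
  simpa using isUnit_hvar_sub_add (K := K) h 0

section Lift

variable {B : Type*} [CommRing B] [Algebra K B]

/-- The universal property of `Ū(n)`. -/
def liftHom (y : Fin n → B)
    (hy : ∀ k l : Fin n, k ≠ l → ∀ a : ℤ, IsUnit (y k - y l + (a : B))) : Ubar K n →ₐ[K] B :=
  IsLocalization.liftAlgHom (M := denominators K n) (f := MvPolynomial.aeval y) (by
    rintro ⟨q, hq⟩
    change q ∈ (IsUnit.submonoid B).comap (MvPolynomial.aeval y : U K n →ₐ[K] B)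
    refine Submonoid.closure_le.2 ?_ hq
    rintro _ ⟨k, l, hkl, a, rfl⟩
    simpa [IsUnit.mem_submonoid_iff] using hy k l hkl a)

@[simp]
theorem liftHom_hvar (y : Fin n → B) (hy) (k : Fin n) :
    liftHom (K := K) y hy (hvar K k) = y k := by
  simp [liftHom, hvar]

theorem ubar_algHom_ext {f g : Ubar K n →ₐ[K] B} (h : ∀ k, f (hvar K k) = g (hvar K k)) :
    f = g := by
  refine IsLocalization.algHom_ext (denominators K n) (MvPolynomial.algHom_ext fun k => ?_)
  exact h k

theorem algHom_algebraMap (f : Ubar K n →ₐ[K] B) (p : U K n) :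
    f (algebraMap _ _ p) = MvPolynomial.aeval (fun k => f (hvar K k)) p := by
  have : f.comp (Algebra.algHom K (U K n) (Ubar K n)) =
      MvPolynomial.aeval (fun k => f (hvar K k)) :=
    MvPolynomial.algHom_ext fun k => by simp [hvar, Algebra.algHom]
  exact DFunLike.congr_fun this p

end Lift

/-- The translation `shift` as a homomorphism of algebras. -/
def shiftHom (K : Type*) [CommRing K] {n : ℕ} (j : Fin n) : Ubar K n →ₐ[K] Ubar K n where
  __ := shift K j
  commutes' c := by
    change shift K j (algebraMap K (Ubar K n) c) = _
    rw [IsScalarTower.algebraMap_apply K (U K n) (Ubar K n), shift, IsLocalization.map_eq]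
    simp

theorem shiftHom_apply (j : Fin n) (f : Ubar K n) : shiftHom K j f = shift K j f := rfl

theorem shiftHom_hvar (j k : Fin n) :
    shiftHom K j (hvar K k) = hvar K k - if k = j then 1 else 0 := by
  rw [shiftHom_apply, hvar, shift, IsLocalization.map_eq]
  simp only [polyShift, RingHom.coe_coe, MvPolynomial.aeval_X, map_sub]
  split_ifs <;> simp

@[simp]
theorem shiftHom_hvar_self (j : Fin n) : shiftHom K j (hvar K j) = hvar K j - 1 := by
  simp [shiftHom_hvar]

theorem shiftHom_hvar_of_ne {j k : Fin n} (h : k ≠ j) : shiftHom K j (hvar K k) = hvar K k := by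
  simp [shiftHom_hvar, h]

theorem shiftHom_comm (i j : Fin n) (f : Ubar K n) :
    shiftHom K i (shiftHom K j f) = shiftHom K j (shiftHom K i f) := by
  have : (shiftHom K i).comp (shiftHom K j) = (shiftHom K j).comp (shiftHom K i) := by
    refine ubar_algHom_ext fun k => ?_
    simp only [AlgHom.comp_apply, shiftHom_hvar, map_sub]
    split_ifs <;> simp
  exact DFunLike.congr_fun this f

theorem Delta_eq (j : Fin n) (f : Ubar K n) : Delta K j f = f - shiftHom K j f := rfl

theorem Delta_sub (j : Fin n) (f g : Ubar K n) :
    Delta K j (f - g) = Delta K j f - Delta K j g := by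
  simp only [Delta_eq, map_sub]; ring

theorem Delta_add (j : Fin n) (f g : Ubar K n) :
    Delta K j (f + g) = Delta K j f + Delta K j g := by
  simp only [Delta_eq, map_add]; ring

theorem Delta_comm (i j : Fin n) (f : Ubar K n) :
    Delta K i (Delta K j f) = Delta K j (Delta K i f) := by
  simp only [Delta_eq, map_sub, shiftHom_comm i j]; ring

theorem Delta_eq_zero_iff {j : Fin n} {f : Ubar K n} : Delta K j f = 0 ↔ shiftHom K j f = f := by
  rw [Delta_eq, sub_eq_zero, eq_comm]

/-- Composites of the translations supply the lattice points from which the rigidity argument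
interpolates. -/
theorem shift_iterate_fixed {f : Ubar K n} (S : Finset (Fin n))
    (hf : ∀ j, j ∉ S → shiftHom K j f = f) (m : Fin n → ℕ) (hm : ∀ k ∈ S, m k = 0) :
    ∃ T : Ubar K n →ₐ[K] Ubar K n, T f = f ∧ ∀ k, T (hvar K k) = hvar K k - (m k : Ubar K n) := by
  suffices H : ∀ A : Finset (Fin n), ∃ T : Ubar K n →ₐ[K] Ubar K n, T f = f ∧
      ∀ k, T (hvar K k) = hvar K k - if k ∈ A then (m k : Ubar K n) else 0 by
    obtain ⟨T, h1, h2⟩ := H Finset.univ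
    exact ⟨T, h1, by simpa using h2⟩
  intro A
  induction A using Finset.induction_on with
  | empty => exact ⟨AlgHom.id K _, by simp⟩
  | insert a A ha ih =>
    obtain ⟨T, h1, h2⟩ := ih
    have hit : ∀ r : ℕ, ∃ R : Ubar K n →ₐ[K] Ubar K n, (a ∉ S → R f = f) ∧
        ∀ k, R (hvar K k) = hvar K k - if k = a then (r : Ubar K n) else 0 := by
      intro r
      induction r with
      | zero => exact ⟨AlgHom.id K _, by simp⟩
      | succ r ihr =>
        obtain ⟨R, h3, h4⟩ := ihr
        refine ⟨(shiftHom K a).comp R, fun h => by simp [h3 h, hf a h], fun k => ?_⟩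
        by_cases hk : k = a <;> simp [h4, hk, shiftHom_hvar]
        ring
    obtain ⟨R, h3, h4⟩ := hit (m a)
    by_cases haS : a ∈ S
    · refine ⟨T, h1, fun k => ?_⟩
      rw [h2]
      by_cases hk : k = a
      · simp [hk, ha, hm a haS]
      · simp [hk]
    · refine ⟨R.comp T, by simp [h1, h3 haS], fun k => ?_⟩
      by_cases hk : k = a
      · subst hk; simp [h2, ha, h4]
      · by_cases hkA : k ∈ A <;> simp [h2, h4, hk, hkA]

/-! ### Rigidity of translation-invariant elements -/

section Rigidity

variable [Algebra ℚ K] {B : Type*} [CommRing B] [Algebra K B]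

theorem isUnit_ratCast (B : Type*) [CommRing B] [Algebra K B] {q : ℚ} (hq : q ≠ 0) :
    IsUnit (algebraMap K B (algebraMap ℚ K q)) :=
  ((IsUnit.mk0 q hq).map _).map _

include K in
theorem isUnit_natCast (m : ℕ) (hm : m ≠ 0) : IsUnit (m : B) := by
  have := isUnit_ratCast (K := K) B (q := m) (by exact_mod_cast hm)
  simpa using this

/-- An element invariant under the translations `-ε_j` with `j ∉ S` only depends on the
variables from `S`. -/
theorem algHom_eq_of_shift_fixed {f : Ubar K n} (S : Finset (Fin n))
    (hf : ∀ j, j ∉ S → shiftHom K j f = f) (ι ψ : Ubar K n →ₐ[K] B)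
    (h : ∀ k ∈ S, ι (hvar K k) = ψ (hvar K k)) : ι f = ψ f := by
  obtain ⟨⟨p, q⟩, hpq⟩ := IsLocalization.surj (denominators K n) f
  simp only at hpq
  let G : U K n → (Fin n → B) → B := fun p y => MvPolynomial.aeval (fun k => ι (hvar K k) - y k) p
  -- The cleared equation f q = p, with only q and p moved to the point ι(h̃) − y. Coordinates of y
  -- outside A are natural numbers; enlarging A frees them one at a time.
  have hG : ∀ A : Finset (Fin n), ∀ y : Fin n → B, (∀ k ∈ S, y k = 0) →
      (∀ k, k ∉ A → ∃ m : ℕ, y k = m) → ι f * G q y = G p y := by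
    intro A
    induction A using Finset.induction_on with
    | empty =>
      intro y hyS hy
      choose m hm using fun k => hy k (by simp)
      classical
      obtain ⟨T, h1, h2⟩ := shift_iterate_fixed S hf (fun k => if k ∈ S then 0 else m k)
        (fun k hk => by simp [hk])
      have h3 := congrArg (ι.comp T) hpq
      rw [map_mul, algHom_algebraMap, algHom_algebraMap, AlgHom.comp_apply, h1] at h3
      have h4 : (fun k => (ι.comp T) (hvar K k)) = fun k => ι (hvar K k) - y k := by
        funext k
        rw [AlgHom.comp_apply, h2]
        by_cases hk : k ∈ S
        · simp [hk, hyS k hk]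
        · simp [hk, hm]
      rw [h4] at h3
      exact h3
    | insert a A ha ih =>
      intro y hyS hy
      by_cases haS : a ∈ S
      · refine ih y hyS fun k hk => ?_
        by_cases hka : k = a
        · exact ⟨0, by rw [hka, hyS a haS, Nat.cast_zero]⟩
        · exact hy k (by simp [hk, hka])
      let Z : Fin n → Polynomial B := fun k => if k = a then
        Polynomial.C (ι (hvar K k)) - Polynomial.X else Polynomial.C (ι (hvar K k) - y k)
      -- The a-th coordinate of y becomes an indeterminate; the resulting polynomial vanishes at
      -- every natural number.
      let P : Polynomial B := Polynomial.C (ι f) * MvPolynomial.aeval Z (q : U K n) -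
        MvPolynomial.aeval Z p
      have hev : ∀ (t : B) (r : U K n), (MvPolynomial.aeval Z r).eval t =
          G r (Function.update y a t) := by
        intro t r
        change (Polynomial.evalRingHom t) _ = _
        simp only [G]
        rw [MvPolynomial.aeval_def, MvPolynomial.aeval_def, MvPolynomial.hom_eval₂]
        congr 1
        · ext c; simp
        · funext k
          by_cases hk : k = a
          · subst hk; simp [Z]
          · simp [Z, hk]
      have hP : P = 0 := by
        refine eq_zero_of_eval_natCast (isUnit_natCast (K := K)) P 0 fun m _ => ?_
        rw [Polynomial.eval_sub, Polynomial.eval_mul, hev, hev, Polynomial.eval_C, sub_eq_zero]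
        refine ih _ (fun k hk => ?_) fun k hk => ?_
        · have : k ≠ a := by rintro rfl; exact haS hk
          simp [this, hyS k hk]
        · by_cases hka : k = a
          · subst hka; exact ⟨m, by simp⟩
          · obtain ⟨m', hm'⟩ := hy k (by simp [hk, hka])
            exact ⟨m', by simp [hka, hm']⟩
      have := congrArg (Polynomial.eval (y a)) hP
      rw [Polynomial.eval_sub, Polynomial.eval_mul, hev, hev, Polynomial.eval_C,
        Polynomial.eval_zero, sub_eq_zero, Function.update_eq_self] at this
      exact this
  -- This y moves the point to ψ(h̃), giving ι(f) ψ(q) = ψ(p) = ψ(f) ψ(q) with ψ(q) a unit.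
  have h1 := hG Finset.univ (fun k => ι (hvar K k) - ψ (hvar K k))
    (fun k hk => by simp [h k hk]) (by simp)
  simp only [G, sub_sub_cancel] at h1
  rw [← algHom_algebraMap, ← algHom_algebraMap, ← hpq, map_mul] at h1
  exact ((IsLocalization.map_units (Ubar K n) q).map ψ).mul_left_injective h1

/-- The pairwise differences of the rational constants `k / n`, `0 ≤ k < n`, are not integers. -/
theorem isUnit_fraction_sub {k l : Fin n} (h : k ≠ l) (a : ℤ) :
    IsUnit (algebraMap K B (algebraMap ℚ K ((k : ℕ) / n)) -
      algebraMap K B (algebraMap ℚ K ((l : ℕ) / n)) + (a : B)) := by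
  have hn : 0 < n := k.pos
  have : ((k : ℕ) / n - (l : ℕ) / n + a : ℚ) ≠ 0 := by
    intro h0
    have hn' : (n : ℚ) ≠ 0 := by positivity
    field_simp at h0
    have h1 : ((k : ℕ) : ℤ) - (l : ℕ) + n * a = 0 := by exact_mod_cast h0
    have hk := k.2
    have hl := l.2
    have hne : (k : ℕ) ≠ l := fun h' => h (Fin.ext h')
    rcases lt_trichotomy a 0 with ha | ha | ha
    · nlinarith
    · subst ha; omega
    · nlinarith
  simpa using isUnit_ratCast (K := K) B this

/-- By rigidity the other variables may be specialized to h̃_i plus rational constants whose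
differences are not integers. All denominators then become invertible constants, so a polynomial
remains. -/
theorem exists_polynomial_of_shift_fixed (i : Fin n) {f : Ubar K n}
    (hf : ∀ j, j ≠ i → shiftHom K j f = f) :
    ∃ p : Polynomial K, f = Polynomial.aeval (hvar K i) p := by
  let c : Fin n → Polynomial K := fun k =>
    algebraMap K (Polynomial K) (algebraMap ℚ K ((k : ℕ) / n))
  let e : Ubar K n →ₐ[K] Polynomial K := liftHom (fun k => Polynomial.X - c i + c k)
    (fun k l hkl a => by
      convert isUnit_fraction_sub (K := K) (B := Polynomial K) hkl a using 1
      simp only [c]; ring)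
  have := algHom_eq_of_shift_fixed {i} (fun j hj => hf j (by simpa using hj)) (AlgHom.id K _)
    ((Polynomial.aeval (hvar K i)).comp e) (by simp [e])
  exact ⟨e f, this⟩

theorem exists_const_of_shift_fixed {f : Ubar K n} (hf : ∀ j, shiftHom K j f = f) :
    ∃ c : K, f = algebraMap K _ c := by
  let e : Ubar K n →ₐ[K] K := liftHom (fun k => algebraMap K K (algebraMap ℚ K ((k : ℕ) / n)))
    (fun k l hkl a => isUnit_fraction_sub hkl a)
  exact ⟨e f, algHom_eq_of_shift_fixed ∅ (fun j _ => hf j) (AlgHom.id K _)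
    ((Algebra.ofId K _).comp e) (by simp)⟩

end Rigidity

end

/-! ### Laurent expansion in one variable -/

noncomputable section

section MapHom

variable {K R S : Type*} [CommRing K] [CommRing R] [CommRing S] [Algebra K R] [Algebra K S]

/-- The coefficientwise algebra structure, to be preferred to the one through power series. -/
instance laurentAlgebra : Algebra K (HahnSeries ℤ R) := HahnSeries.instAlgebra

/-- A homomorphism of algebras acts on the coefficients of Laurent series. -/
def laurentMap (T : R →ₐ[K] S) : HahnSeries ℤ R →ₐ[K] HahnSeries ℤ S where
  toFun F := F.map T
  map_one' := HahnSeries.map_one (RingHom.toMonoidWithZeroHom (T : R →+* S))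
  map_mul' F G := HahnSeries.map_mul ((T : R →+* S) : R →ₙ+* S)
  map_zero' := by ext; simp
  map_add' F G := by ext; simp
  commutes' c := by
    ext m
    simp only [HahnSeries.algebraMap_apply, HahnSeries.map_coeff, HahnSeries.C_apply,
      HahnSeries.coeff_single]
    split_ifs <;> simp

@[simp]
theorem laurentMap_coeff (T : R →ₐ[K] S) (F : HahnSeries ℤ R) (m : ℤ) :
    (laurentMap T F).coeff m = T (F.coeff m) := rfl

theorem laurentMap_single (T : R →ₐ[K] S) (m : ℤ) (r : R) :
    laurentMap T (HahnSeries.single m r) = HahnSeries.single m (T r) := by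
  ext k
  simp only [laurentMap_coeff, HahnSeries.coeff_single]
  split_ifs <;> simp

theorem laurentMap_C (T : R →ₐ[K] S) (r : R) :
    laurentMap T (HahnSeries.C r) = HahnSeries.C (T r) :=
  laurentMap_single T 0 r

/-- With x the series variable, x⁻¹ − c = x⁻¹(1 − xc), and 1 − xc is an invertible power series. -/
theorem isUnit_single_sub_C (c : R) :
    IsUnit (HahnSeries.single (-1 : ℤ) (1 : R) - HahnSeries.C c) := by
  have h1 : IsUnit (HahnSeries.single (-1 : ℤ) (1 : R)) :=
    IsUnit.of_mul_eq_one (HahnSeries.single (1 : ℤ) (1 : R)) (by simp)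
  have h2 : IsUnit (1 - PowerSeries.X * PowerSeries.C c : PowerSeries R) := by
    rw [PowerSeries.isUnit_iff_constantCoeff]; simp
  have h3 := h1.mul (h2.map (HahnSeries.ofPowerSeries ℤ R))
  rw [map_sub (HahnSeries.ofPowerSeries ℤ R), map_one (HahnSeries.ofPowerSeries ℤ R),
    map_mul (HahnSeries.ofPowerSeries ℤ R), HahnSeries.ofPowerSeries_X, HahnSeries.ofPowerSeries_C,
    mul_sub, mul_one, ← mul_assoc, HahnSeries.single_mul_single, neg_add_cancel, mul_one,
    HahnSeries.single_zero_one, one_mul] at h3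
  exact h3

theorem isUnit_single_sub_C_add (c : R) (a : ℤ) :
    IsUnit (HahnSeries.single (-1 : ℤ) (1 : R) - HahnSeries.C c + (a : HahnSeries ℤ R)) := by
  have := isUnit_single_sub_C (c - (a : R))
  rwa [map_sub, map_intCast, ← sub_add] at this

theorem isUnit_C_sub_add {b c : R} {a : ℤ} (h : IsUnit (b - c + (a : R))) :
    IsUnit (HahnSeries.C b - HahnSeries.C c + (a : HahnSeries ℤ R)) := by
  have := h.map (HahnSeries.C : R →+* HahnSeries ℤ R)
  rwa [map_add, map_sub, map_intCast] at this

variable (K R) in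
/-- The constant Laurent series. -/
def laurentC : R →ₐ[K] HahnSeries ℤ R :=
  { (HahnSeries.C : R →+* HahnSeries ℤ R) with commutes' := fun _ => rfl }

end MapHom

variable {K : Type*} [CommRing K] {n : ℕ}

/-- The expansion of elements of `Ū(n)` in powers of `1 / h̃_i`. -/
def laurent (i : Fin n) : Ubar K n →ₐ[K] HahnSeries ℤ (Ubar K n) :=
  liftHom (fun k => if k = i then HahnSeries.single (-1) 1 else HahnSeries.C (hvar K k))
    (fun k l hkl a => by
      by_cases hk : k = i
      · rw [if_pos hk, if_neg (fun hl => hkl (hk.trans hl.symm))]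
        exact isUnit_single_sub_C_add _ a
      · by_cases hl : l = i
        · rw [if_neg hk, if_pos hl]
          convert (isUnit_single_sub_C_add (hvar K k) (-a)).neg using 1
          push_cast; ring
        · rw [if_neg hk, if_neg hl]
          exact isUnit_C_sub_add (isUnit_hvar_sub_add hkl a))

@[simp]
theorem laurent_hvar_self (i : Fin n) : laurent i (hvar K i) = HahnSeries.single (-1) 1 := by
  simp [laurent]

theorem laurent_hvar_of_ne {i k : Fin n} (h : k ≠ i) :
    laurent i (hvar K k) = HahnSeries.C (hvar K k) := by
  simp [laurent, h]

/-- The coefficient of `h̃_i ^ (-m)` in the expansion in powers of `1 / h̃_i`. -/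
def coef (i : Fin n) (m : ℤ) (f : Ubar K n) : Ubar K n := (laurent i f).coeff m

@[simp]
theorem coef_zero (i : Fin n) (m : ℤ) : coef i m (0 : Ubar K n) = 0 := by simp [coef]

theorem coef_add (i : Fin n) (m : ℤ) (f g : Ubar K n) :
    coef i m (f + g) = coef i m f + coef i m g := by simp [coef]

theorem coef_sub (i : Fin n) (m : ℤ) (f g : Ubar K n) :
    coef i m (f - g) = coef i m f - coef i m g := by simp [coef]

theorem coef_sum {ι : Type*} (i : Fin n) (m : ℤ) (s : Finset ι) (f : ι → Ubar K n) :
    coef i m (∑ a ∈ s, f a) = ∑ a ∈ s, coef i m (f a) := by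
  classical
  induction s using Finset.induction_on with
  | empty => simp
  | insert a s ha ih => rw [Finset.sum_insert ha, Finset.sum_insert ha, coef_add, ih]

theorem coef_smul (i : Fin n) (m : ℤ) (c : K) (f : Ubar K n) :
    coef i m (c • f) = c • coef i m f := by simp [coef]

theorem coef_hvar_self_mul (i : Fin n) (m : ℤ) (f : Ubar K n) :
    coef i m (hvar K i * f) = coef i (m + 1) f := by
  simp [coef, HahnSeries.coeff_single_mul]

theorem coef_hvar_mul {i k : Fin n} (h : k ≠ i) (m : ℤ) (f : Ubar K n) :
    coef i m (hvar K k * f) = hvar K k * coef i m f := by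
  simp [coef, laurent_hvar_of_ne h]

theorem shiftHom_coef {i j : Fin n} (h : j ≠ i) (m : ℤ) (f : Ubar K n) :
    shiftHom K j (coef i m f) = coef i m (shiftHom K j f) := by
  have : (laurentMap (shiftHom K j)).comp (laurent i) = (laurent i).comp (shiftHom K j) := by
    refine ubar_algHom_ext fun k => ?_
    by_cases hk : k = i
    · subst hk
      simp [laurentMap_single, shiftHom_hvar, h.symm]
    · by_cases hkj : k = j
      · subst hkj
        rw [AlgHom.comp_apply, AlgHom.comp_apply, laurent_hvar_of_ne hk, laurentMap_C,
          shiftHom_hvar_self, map_sub, map_sub, map_one, map_one, laurent_hvar_of_ne hk]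
      · rw [AlgHom.comp_apply, AlgHom.comp_apply, laurent_hvar_of_ne hk, laurentMap_C,
          shiftHom_hvar_of_ne hkj, laurent_hvar_of_ne hk]
  exact congrArg (fun F => F.coeff m) (DFunLike.congr_fun this f)

theorem shiftHom_coef_self (i : Fin n) (m : ℤ) (f : Ubar K n) :
    shiftHom K i (coef i m f) = coef i m f := by
  have : (laurentMap (shiftHom K i)).comp (laurent i) = laurent i := by
    refine ubar_algHom_ext fun k => ?_
    by_cases hk : k = i
    · subst hk
      simp [laurentMap_single]
    · rw [AlgHom.comp_apply, laurent_hvar_of_ne hk, laurentMap_C, shiftHom_hvar_of_ne hk]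
  exact congrArg (fun F => F.coeff m) (DFunLike.congr_fun this f)

theorem Delta_coef {i j : Fin n} (h : j ≠ i) (m : ℤ) (f : Ubar K n) :
    Delta K j (coef i m f) = coef i m (Delta K j f) := by
  rw [Delta_eq, Delta_eq, coef_sub, shiftHom_coef h]

theorem shiftHom_coef_of_fixed {i k : Fin n} {f : Ubar K n} (h : k ≠ i → shiftHom K k f = f)
    (m : ℤ) : shiftHom K k (coef i m f) = coef i m f := by
  by_cases hk : k = i
  · rw [hk, shiftHom_coef_self]
  · rw [shiftHom_coef hk, h hk]

theorem exists_coef_eq_zero (i : Fin n) (f : Ubar K n) :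
    ∃ M : ℕ, ∀ m : ℤ, m ≤ -M → coef i m f = 0 := by
  by_cases hf : laurent i f = 0
  · exact ⟨0, fun m _ => by simp [coef, hf]⟩
  · refine ⟨((laurent i f).order).natAbs + 1, fun m hm => ?_⟩
    exact HahnSeries.coeff_eq_zero_of_lt_order (by omega)

/-- The expansion and the embedding as constant series agree on all generators but h̃_i, so rigidity
applies. -/
theorem laurent_of_shift_fixed [Algebra ℚ K] {i : Fin n} {f : Ubar K n}
    (h : shiftHom K i f = f) : laurent i f = HahnSeries.C f := by
  exact algHom_eq_of_shift_fixed (Finset.univ.erase i) (fun j hj => by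
    obtain rfl : j = i := by simpa using hj
    exact h) (laurent i) (laurentC K (Ubar K n)) fun k hk =>
      laurent_hvar_of_ne (Finset.ne_of_mem_erase hk)

theorem coef_mul_of_shift_fixed [Algebra ℚ K] {i : Fin n} {f : Ubar K n}
    (h : shiftHom K i f = f) (m : ℤ) (g : Ubar K n) : coef i m (f * g) = f * coef i m g := by
  simp [coef, laurent_of_shift_fixed h]

theorem coef_of_shift_fixed [Algebra ℚ K] {i : Fin n} {f : Ubar K n}
    (h : shiftHom K i f = f) (m : ℤ) : coef i m f = if m = 0 then f else 0 := by
  simp [coef, laurent_of_shift_fixed h, HahnSeries.coeff_single]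

/-- If `(h̃_i - h̃_k) g` has leading term `h̃_i ^ (-d)`, then `g` has leading term
`h̃_i ^ (-d - 1)`. -/
theorem coef_of_hvar_sub_mul {i k : Fin n} (h : k ≠ i) {g : Ubar K n} {d : ℤ}
    (h0 : ∀ m < d, coef i m ((hvar K i - hvar K k) * g) = 0)
    (h1 : coef i d ((hvar K i - hvar K k) * g) = 1) :
    (∀ m < d + 1, coef i m g = 0) ∧ coef i (d + 1) g = 1 := by
  have hrec : ∀ m, coef i (m + 1) g =
      coef i m ((hvar K i - hvar K k) * g) + hvar K k * coef i m g := fun m => by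
    rw [sub_mul, coef_sub, coef_hvar_self_mul, coef_hvar_mul h]; ring
  have hz : ∀ m < d + 1, coef i m g = 0 := by
    obtain ⟨M, hM⟩ := exists_coef_eq_zero i g
    -- The recursion climbs from −M, where the coefficients of g vanish.
    suffices H : ∀ r : ℕ, -(M : ℤ) + r < d + 1 → coef i (-(M : ℤ) + r) g = 0 by
      intro m hm
      by_cases hmM : m ≤ -M
      · exact hM m hmM
      · have := H (m + M).toNat
        rw [Int.toNat_of_nonneg (by omega)] at this
        simpa using this (by linarith)
    intro r
    induction r with
    | zero => intro _; exact hM _ (by simp)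
    | succ r ih =>
      intro hr
      push_cast at hr ⊢
      rw [← add_assoc, hrec, h0 _ (by linarith), ih (by linarith), mul_zero, add_zero]
  exact ⟨hz, by rw [hrec, h1, hz d (by linarith), mul_zero, add_zero]⟩

end

/-! ### Partial fractions and the potential equations -/

noncomputable section

variable {K : Type*} [CommRing K] {n : ℕ}

/-- The inverse of `h̃_k - h̃_l`. -/
def hinv (K : Type*) [CommRing K] {n : ℕ} (k l : Fin n) : Ubar K n :=
  Ring.inverse (hvar K k - hvar K l)

theorem hvar_sub_mul_hinv {k l : Fin n} (h : k ≠ l) :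
    (hvar K k - hvar K l) * hinv K k l = 1 :=
  Ring.mul_inverse_cancel _ (isUnit_hvar_sub h)

theorem hinv_eq_of_mul_eq_one {k l : Fin n} (h : k ≠ l) {x : Ubar K n}
    (hx : (hvar K k - hvar K l) * x = 1) : x = hinv K k l :=
  (isUnit_hvar_sub h).mul_right_injective (hx.trans (hvar_sub_mul_hinv h).symm)

theorem shiftHom_hvar_sub {j k l : Fin n} (hk : k ≠ j) (hl : l ≠ j) :
    shiftHom K j (hvar K k - hvar K l) = hvar K k - hvar K l := by
  rw [map_sub, shiftHom_hvar_of_ne hk, shiftHom_hvar_of_ne hl]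

theorem shiftHom_hinv {j k l : Fin n} (h : k ≠ l) (hk : k ≠ j) (hl : l ≠ j) :
    shiftHom K j (hinv K k l) = hinv K k l := by
  refine hinv_eq_of_mul_eq_one h ?_
  rw [← shiftHom_hvar_sub hk hl, ← map_mul, hvar_sub_mul_hinv h, map_one]

/-- The inverse of the product of `h̃_k - h̃_l` over `l ∈ A`. -/
def hprod (K : Type*) [CommRing K] {n : ℕ} (k : Fin n) (A : Finset (Fin n)) : Ubar K n :=
  ∏ l ∈ A, hinv K k l

theorem hprod_insert (k : Fin n) {a : Fin n} {A : Finset (Fin n)} (h : a ∉ A) :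
    hprod K k (insert a A) = hinv K k a * hprod K k A := Finset.prod_insert h

theorem prod_hvar_sub_mul_hprod {k : Fin n} {A : Finset (Fin n)} (h : k ∉ A) :
    (∏ l ∈ A, (hvar K k - hvar K l)) * hprod K k A = 1 := by
  rw [hprod, ← Finset.prod_mul_distrib]
  exact Finset.prod_eq_one fun l hl => hvar_sub_mul_hinv (by rintro rfl; exact h hl)

theorem shiftHom_hprod {j k : Fin n} {A : Finset (Fin n)} (hk : k ∉ A) (hkj : k ≠ j)
    (hj : j ∉ A) : shiftHom K j (hprod K k A) = hprod K k A := by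
  rw [hprod, map_prod]
  exact Finset.prod_congr rfl fun l hl => shiftHom_hinv (by rintro rfl; exact hk hl) hkj
    (by rintro rfl; exact hj hl)

theorem shiftHom_aeval_hvar {j k : Fin n} (h : k ≠ j) (p : Polynomial K) :
    shiftHom K j (Polynomial.aeval (hvar K k) p) = Polynomial.aeval (hvar K k) p := by
  rw [← Polynomial.aeval_algHom_apply, shiftHom_hvar_of_ne h]

theorem shiftHom_aeval_mul_hprod {j k : Fin n} {A : Finset (Fin n)} (hk : k ∉ A) (hkj : k ≠ j)
    (hj : j ∉ A) (p : Polynomial K) :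
    shiftHom K j (Polynomial.aeval (hvar K k) p * hprod K k A) =
      Polynomial.aeval (hvar K k) p * hprod K k A := by
  rw [map_mul, shiftHom_aeval_hvar hkj, shiftHom_hprod hk hkj hj]

/-- The equations satisfied by the potentials, for the variables from `S`. -/
def IsPotential (S : Finset (Fin n)) (f : Ubar K n) : Prop :=
  ∀ i ∈ S, ∀ j ∈ S, i ≠ j → Delta K i (Delta K j ((hvar K i - hvar K j) * f)) = 0

theorem Delta_zero (j : Fin n) : Delta K j 0 = 0 := by simp [Delta_eq]

namespace IsPotential

variable {S : Finset (Fin n)} {f g : Ubar K n}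

theorem zero : IsPotential S (0 : Ubar K n) := fun i _ j _ _ => by
  rw [mul_zero, Delta_zero, Delta_zero]

theorem add (hf : IsPotential S f) (hg : IsPotential S g) : IsPotential S (f + g) :=
  fun i hi j hj h => by
    rw [mul_add, Delta_add, Delta_add, hf i hi j hj h, hg i hi j hj h, add_zero]

theorem sub (hf : IsPotential S f) (hg : IsPotential S g) : IsPotential S (f - g) :=
  fun i hi j hj h => by
    rw [mul_sub, Delta_sub, Delta_sub, hf i hi j hj h, hg i hi j hj h, sub_zero]

theorem sum {ι : Type*} {s : Finset ι} {f : ι → Ubar K n} (h : ∀ a ∈ s, IsPotential S (f a)) :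
    IsPotential S (∑ a ∈ s, f a) :=
  Finset.sum_induction f (IsPotential S) (fun _ _ => add) zero h

end IsPotential

theorem Delta_Delta_eq_zero_of_fixed {i j : Fin n} {f : Ubar K n} (h : shiftHom K j f = f) :
    Delta K i (Delta K j f) = 0 := by
  rw [Delta_eq_zero_iff.2 h, Delta_zero]

theorem Delta_Delta_eq_zero_of_fixed' {i j : Fin n} {f : Ubar K n} (h : shiftHom K i f = f) :
    Delta K i (Delta K j f) = 0 := by
  rw [Delta_comm, Delta_Delta_eq_zero_of_fixed h]

/-- If k is i or j, the factor h̃_i − h̃_j cancels a denominator and the other variable disappears.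
Otherwise h̃_i − h̃_j = (h̃_k − h̃_j) − (h̃_k − h̃_i) splits the product into a term free of h̃_j
and one free of h̃_i. -/
theorem isPotential_aeval_mul_hprod {S : Finset (Fin n)} (k : Fin n)
    (p : Polynomial K) :
    IsPotential S (Polynomial.aeval (hvar K k) p * hprod K k (S.erase k)) := by
  intro i hi j hj hij
  by_cases hki : k = i
  · subst hki
    have h1 : (hvar K k - hvar K j) * (Polynomial.aeval (hvar K k) p * hprod K k (S.erase k)) =
        Polynomial.aeval (hvar K k) p * hprod K k ((S.erase k).erase j) := by
      rw [← Finset.insert_erase (Finset.mem_erase.2 ⟨hij.symm, hj⟩),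
        hprod_insert _ (Finset.notMem_erase _ _),
        Finset.erase_insert (Finset.notMem_erase _ _)]
      linear_combination (Polynomial.aeval (hvar K k) p * hprod K k ((S.erase k).erase j)) *
        hvar_sub_mul_hinv (K := K) hij
    rw [h1]
    exact Delta_Delta_eq_zero_of_fixed
      (shiftHom_aeval_mul_hprod (by simp) hij (by simp) p)
  by_cases hkj : k = j
  · subst hkj
    have h1 : (hvar K i - hvar K k) * (Polynomial.aeval (hvar K k) p * hprod K k (S.erase k)) =
        Polynomial.aeval (hvar K k) (-p) * hprod K k ((S.erase k).erase i) := by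
      rw [← Finset.insert_erase (Finset.mem_erase.2 ⟨hij, hi⟩),
        hprod_insert _ (Finset.notMem_erase _ _),
        Finset.erase_insert (Finset.notMem_erase _ _), map_neg]
      linear_combination (-Polynomial.aeval (hvar K k) p * hprod K k ((S.erase k).erase i)) *
        hvar_sub_mul_hinv (K := K) hij.symm
    rw [h1]
    exact Delta_Delta_eq_zero_of_fixed'
      (shiftHom_aeval_mul_hprod (by simp) hij.symm (by simp) (-p))
  set A := ((S.erase k).erase j).erase i with hA
  have hjS : insert j ((S.erase k).erase j) = S.erase k :=
    Finset.insert_erase (Finset.mem_erase.2 ⟨Ne.symm hkj, hj⟩)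
  have hiS : insert i A = (S.erase k).erase j :=
    Finset.insert_erase (by simp [hij, hi, Ne.symm hki])
  have hiA : i ∉ A := by simp [hA]
  have hjA : j ∉ A := by simp [hA]
  have hkA : k ∉ A := by simp [hA]
  have h1 : (hvar K i - hvar K j) * (Polynomial.aeval (hvar K k) p * hprod K k (S.erase k)) =
      Polynomial.aeval (hvar K k) p * hprod K k (insert i A) -
      Polynomial.aeval (hvar K k) p * hprod K k (insert j A) := by
    rw [← hjS, hprod_insert _ (Finset.notMem_erase _ _), ← hiS, hprod_insert _ hiA,
      hprod_insert _ hjA]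
    linear_combination (Polynomial.aeval (hvar K k) p * hprod K k A) *
      (hinv K k i * hvar_sub_mul_hinv (K := K) hkj - hinv K k j * hvar_sub_mul_hinv (K := K) hki)
  rw [h1, Delta_sub, Delta_sub, Delta_Delta_eq_zero_of_fixed, Delta_Delta_eq_zero_of_fixed',
    sub_zero]
  · exact shiftHom_aeval_mul_hprod (by simp [hkj, hkA]) hki (by simp [hij, hiA]) p
  · exact shiftHom_aeval_mul_hprod (by simp [hki, hkA]) hkj (by simp [hij.symm, hjA]) p

theorem coef_pow_mul_hprod {i : Fin n} {A : Finset (Fin n)} (h : i ∉ A) (N : ℕ) :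
    (∀ m < (A.card : ℤ) - N, coef i m (hvar K i ^ N * hprod K i A) = 0) ∧
      coef i ((A.card : ℤ) - N) (hvar K i ^ N * hprod K i A) = 1 := by
  induction A using Finset.induction_on with
  | empty =>
    have : ∀ m, coef i m (hvar K i ^ N * hprod K i ∅) = if m = -(N : ℤ) then 1 else 0 := by
      intro m
      simp [coef, hprod, HahnSeries.single_pow, HahnSeries.coeff_single]
    refine ⟨fun m hm => ?_, ?_⟩
    · rw [this, if_neg]
      simp at hm
      omega
    · rw [this, if_pos]; simp
  | insert a A ha ih =>
    obtain ⟨hia, hiA⟩ : i ≠ a ∧ i ∉ A := by simpa using h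
    have h1 : (hvar K i - hvar K a) * (hvar K i ^ N * hprod K i (insert a A)) =
        hvar K i ^ N * hprod K i A := by
      rw [hprod_insert _ ha]
      linear_combination (hvar K i ^ N * hprod K i A) * hvar_sub_mul_hinv (K := K) hia
    have h2 := ih hiA
    rw [← h1] at h2
    have h3 := coef_of_hvar_sub_mul hia.symm h2.1 h2.2
    rw [Finset.card_insert_of_notMem ha]
    push_cast
    rwa [show (A.card : ℤ) + 1 - N = A.card - N + 1 by ring]

theorem coef_hinv {i k : Fin n} (h : i ≠ k) :
    (∀ m ≤ 0, coef i m (hinv K k i) = 0) ∧ coef i 1 (hinv K k i) = -1 := by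
  have h1 : hinv K k i = 0 - hinv K i k := by
    refine (hinv_eq_of_mul_eq_one h.symm ?_).symm
    linear_combination hvar_sub_mul_hinv (K := K) h
  have h2 := coef_pow_mul_hprod (K := K) (i := i) (A := {k}) (by simpa using h) 0
  simp only [pow_zero, one_mul, hprod, Finset.prod_singleton, Finset.card_singleton] at h2
  refine ⟨fun m hm => ?_, ?_⟩
  · rw [h1, coef_sub, coef_zero, h2.1 m (by push_cast; omega), sub_zero]
  · have := h2.2
    rw [h1, coef_sub, coef_zero, zero_sub, neg_inj]
    simpa using this

/-! ### Classification and existence of potentials -/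

section Main

variable [Algebra ℚ K]

/-- Since Δ_j(h̃_ij f) is invariant under −ε_i, its expansion in 1/h̃_i has only a constant term. -/
theorem IsPotential.Delta_coef_sub {S : Finset (Fin n)} {i j : Fin n} {f : Ubar K n}
    (hf : IsPotential S f) (hi : i ∈ S) (hj : j ∈ S) (h : i ≠ j) (m : ℤ) :
    Delta K j (coef i (m + 1) f - hvar K j * coef i m f) =
      if m = 0 then Delta K j ((hvar K i - hvar K j) * f) else 0 := by
  rw [← coef_of_shift_fixed (Delta_eq_zero_iff.1 (hf i hi j hj h)) m, ← Delta_coef h.symm,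
    sub_mul, coef_sub, coef_hvar_self_mul, coef_hvar_mul h.symm]

/-- Below index 1, `IsPotential.Delta_coef_sub` makes the leading coefficient a scalar from K, so a
multiple of one element of the required form removes it; this repeats down to h̃_i ^ 0. -/
theorem exists_coef_sub_eq_zero {S : Finset (Fin n)} {i : Fin n} (hi : i ∉ S) (M : ℕ)
    {f : Ubar K n} (hfix : ∀ k, k ∉ insert i S → shiftHom K k f = f)
    (hf : IsPotential (insert i S) f) (hM : ∀ m : ℤ, m ≤ -M → coef i m f = 0) :
    ∃ p : Polynomial K, ∀ m : ℤ, m ≤ 0 →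
      coef i m (f - Polynomial.aeval (hvar K i) p * hprod K i S) = 0 := by
  induction M generalizing f with
  | zero => exact ⟨0, fun m hm => by simpa using hM m (by simpa using hm)⟩
  | succ M ih =>
    push_cast at hM
    obtain ⟨c, hc⟩ : ∃ c : K, coef i (-(M : ℤ)) f = algebraMap K _ c := by
      refine exists_const_of_shift_fixed fun k => ?_
      by_cases hki : k = i
      · rw [hki, shiftHom_coef_self]
      by_cases hkS : k ∈ S
      · have := hf.Delta_coef_sub (Finset.mem_insert_self i S) (Finset.mem_insert_of_mem hkS)
          (Ne.symm hki) (-(M + 1))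
        rw [hM _ le_rfl, mul_zero, sub_zero, if_neg (by omega),
          show -((M : ℤ) + 1) + 1 = -M by ring] at this
        exact Delta_eq_zero_iff.1 this
      · exact shiftHom_coef_of_fixed (fun _ => hfix k (by simp [hki, hkS])) _
    have hlead := coef_pow_mul_hprod (K := K) hi (M + S.card)
    push_cast at hlead
    rw [show (S.card : ℤ) - (M + S.card) = -M by ring] at hlead
    -- `hprod K i S` begins at h̃_i ^ (−|S|), so this degree yields the leading term c h̃_i ^ M.
    set q : Polynomial K := Polynomial.C c * Polynomial.X ^ (M + S.card) with hq
    have hqe : Polynomial.aeval (hvar K i) q * hprod K i S =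
        c • (hvar K i ^ (M + S.card) * hprod K i S) := by
      rw [hq, map_mul, Polynomial.aeval_C, map_pow, Polynomial.aeval_X, Algebra.smul_def, mul_assoc]
    have hpot := isPotential_aeval_mul_hprod (S := insert i S) i q
    rw [Finset.erase_insert hi] at hpot
    obtain ⟨p, hp⟩ := ih (f := f - Polynomial.aeval (hvar K i) q * hprod K i S)
      (fun k hk => by
        obtain ⟨hki, hkS⟩ : k ≠ i ∧ k ∉ S := by simpa using hk
        rw [map_sub, hfix k hk, shiftHom_aeval_mul_hprod hi hki.symm hkS])
      (hf.sub hpot)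
      (fun m hm => by
        rw [hqe, coef_sub, coef_smul]
        rcases hm.lt_or_eq with hm | rfl
        · rw [hM m (by omega), hlead.1 m hm, smul_zero, sub_zero]
        · rw [hc, hlead.2, Algebra.smul_def, mul_one, sub_self])
    refine ⟨q + p, fun m hm => ?_⟩
    rw [← hp m hm, map_add, add_mul, sub_sub]

/-- Multiplying g by all h̃_i − h̃_l gives an element invariant in every direction j ≠ i: the factor
with l = j is absorbed by the hypothesis, the others do not involve h̃_j. -/
theorem exists_eq_aeval_mul_hprod {S : Finset (Fin n)} {i : Fin n} (hi : i ∉ S)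
    {g : Ubar K n} (hfix : ∀ k, k ∉ insert i S → shiftHom K k g = g)
    (hg : ∀ j ∈ S, shiftHom K j ((hvar K i - hvar K j) * g) = (hvar K i - hvar K j) * g) :
    ∃ p : Polynomial K, g = Polynomial.aeval (hvar K i) p * hprod K i S := by
  obtain ⟨p, hp⟩ := exists_polynomial_of_shift_fixed i
    (f := (∏ l ∈ S, (hvar K i - hvar K l)) * g) (fun j hji => by
      have hfac : ∀ A : Finset (Fin n), j ∉ A →
          shiftHom K j (∏ l ∈ A, (hvar K i - hvar K l)) = ∏ l ∈ A, (hvar K i - hvar K l) := by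
        intro A hA
        rw [map_prod]
        exact Finset.prod_congr rfl fun l hl =>
          shiftHom_hvar_sub hji.symm (by rintro rfl; exact hA hl)
      by_cases hj : j ∈ S
      · rw [← Finset.prod_erase_mul _ _ hj, mul_assoc, map_mul, hg j hj,
          hfac _ (Finset.notMem_erase _ _)]
      · rw [map_mul, hfac S hj, hfix j (by simp [hji, hj])])
  refine ⟨p, ?_⟩
  rw [← hp]
  linear_combination (-g) * prod_hvar_sub_mul_hprod (K := K) hi

theorem IsPotential.exists_eq_sum {S : Finset (Fin n)} (hS : S.Nonempty) {f : Ubar K n}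
    (hfix : ∀ k, k ∉ S → shiftHom K k f = f) (hf : IsPotential S f) :
    ∃ π : Fin n → Polynomial K,
      f = ∑ k ∈ S, Polynomial.aeval (hvar K k) (π k) * hprod K k (S.erase k) := by
  induction hS using Finset.Nonempty.cons_induction generalizing f with
  | singleton i =>
    obtain ⟨p, hp⟩ := exists_polynomial_of_shift_fixed i (fun j hj => hfix j (by simpa using hj))
    exact ⟨fun _ => p, by simp [hprod, hp]⟩
  | cons i S hi hS ih =>
    rw [Finset.cons_eq_insert] at *
    have hne : ∀ k ∈ S, i ≠ k := fun k hk h => hi (h ▸ hk)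
    have herase : ∀ k ∈ S, (insert i S).erase k = insert i (S.erase k) :=
      fun k hk => Finset.erase_insert_of_ne (hne k hk)
    obtain ⟨M, hM⟩ := exists_coef_eq_zero i f
    obtain ⟨p, hp⟩ := exists_coef_sub_eq_zero hi M hfix hf hM
    set g := f - Polynomial.aeval (hvar K i) p * hprod K i S with hg
    have hginv : ∀ k, k ∉ insert i S → shiftHom K k g = g := fun k hk => by
      obtain ⟨hki, hkS⟩ : k ≠ i ∧ k ∉ S := by simpa using hk
      rw [hg, map_sub, hfix k hk, shiftHom_aeval_mul_hprod hi hki.symm hkS]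
    have hgpot : IsPotential (insert i S) g := by
      have hpot := isPotential_aeval_mul_hprod (S := insert i S) i p
      rw [Finset.erase_insert hi] at hpot
      exact hf.sub hpot
    -- Taking coefficients commutes with Δ_a and with h̃_a − h̃_b for a, b ≠ i, so the equations for
    -- S pass to the coefficient of 1/h̃_i.
    obtain ⟨π, hπ⟩ := ih (f := coef i 1 g)
      (fun k hk => shiftHom_coef_of_fixed (fun hki => hginv k (by simp [hki, hk])) 1)
      (fun a ha b hb hab => by
        have := congrArg (coef i 1) (hgpot a (Finset.mem_insert_of_mem ha) b
          (Finset.mem_insert_of_mem hb) hab)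
        rw [coef_zero, ← HDeformed.Delta_coef (hne a ha).symm,
          ← HDeformed.Delta_coef (hne b hb).symm, sub_mul,
          coef_sub, coef_hvar_mul (hne a ha).symm, coef_hvar_mul (hne b hb).symm,
          ← sub_mul] at this
        exact this)
    -- The additional factor 1/(h̃_k − h̃_i) = −1/h̃_i + ⋯ makes w cancel the coefficient of 1/h̃_i
    -- in g.
    set w := ∑ k ∈ S, Polynomial.aeval (hvar K k) (π k) * hprod K k ((insert i S).erase k) with hw
    have hcoef : ∀ m, coef i m w = ∑ k ∈ S, Polynomial.aeval (hvar K k) (π k) *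
        hprod K k (S.erase k) * coef i m (hinv K k i) := fun m => by
      rw [hw, coef_sum]
      refine Finset.sum_congr rfl fun k hk => ?_
      rw [herase k hk, hprod_insert _ (by simp [hi]), mul_left_comm, mul_comm (hinv K k i)]
      exact coef_mul_of_shift_fixed (shiftHom_aeval_mul_hprod (by simp) (hne k hk).symm
        (by simp [hi]) (π k)) _ _
    have hw0 : ∀ m ≤ 0, coef i m w = 0 := fun m hm => by
      rw [hcoef]
      exact Finset.sum_eq_zero fun k hk => by rw [(coef_hinv (hne k hk)).1 m hm, mul_zero]
    have hw1 : coef i 1 w = -coef i 1 g := by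
      rw [hcoef, hπ, ← Finset.sum_neg_distrib]
      exact Finset.sum_congr rfl fun k hk => by
        rw [(coef_hinv (hne k hk)).2]; ring
    have hwpot : IsPotential (insert i S) w :=
      IsPotential.sum fun k _ => isPotential_aeval_mul_hprod k (π k)
    have hwinv : ∀ k, k ∉ insert i S → shiftHom K k w = w := fun k hk => by
      obtain ⟨hki, hkS⟩ : k ≠ i ∧ k ∉ S := by simpa using hk
      rw [hw, map_sum]
      exact Finset.sum_congr rfl fun l hl => shiftHom_aeval_mul_hprod (by simp)
        (by rintro rfl; exact hkS hl) (by simp [hki, hkS]) (π l)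
    -- Coefficients 0 and 1 of g + w vanish, so the relation at m = 0 reads Δ_j(h̃_ij (g + w)) = 0.
    obtain ⟨q, hq⟩ := exists_eq_aeval_mul_hprod hi (g := g + w)
      (fun k hk => by rw [map_add, hginv k hk, hwinv k hk])
      (fun j hj => by
        have := (hgpot.add hwpot).Delta_coef_sub (Finset.mem_insert_self i S)
          (Finset.mem_insert_of_mem hj) (hne j hj) 0
        rw [if_pos rfl, zero_add, coef_add, coef_add, hp 0 le_rfl, hw0 0 le_rfl, hw1] at this
        rw [← Delta_eq_zero_iff, ← this]
        simp [Delta_zero])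
    refine ⟨fun k => if k = i then p + q else -π k, ?_⟩
    rw [Finset.sum_insert hi, Finset.erase_insert hi]
    beta_reduce
    rw [if_pos rfl, map_add, add_mul, ← hq]
    have : ∑ k ∈ S, Polynomial.aeval (hvar K k) (if k = i then p + q else -π k) *
        hprod K k ((insert i S).erase k) = -w := by
      rw [hw, ← Finset.sum_neg_distrib]
      exact Finset.sum_congr rfl fun k hk => by
        rw [if_neg (hne k hk).symm, map_neg]; ring
    rw [this, hg]
    ring

/-- A difference analogue of the Poincaré lemma. -/
theorem exists_potential (S : Finset (Fin n)) (σ : Fin n → Ubar K n)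
    (hΔ : ∀ i ∈ S, ∃ t, (∀ k, k ∉ S → shiftHom K k t = t) ∧ Delta K i t = σ i)
    (hσ : ∀ i ∈ S, ∀ j ∈ S, Delta K i (σ j) = Delta K j (σ i)) :
    ∃ t, (∀ k, k ∉ S → shiftHom K k t = t) ∧ ∀ i ∈ S, Delta K i t = σ i := by
  induction S using Finset.induction_on generalizing σ with
  | empty => exact ⟨0, by simp⟩
  | insert i S hi ih =>
    have hne : ∀ k ∈ S, k ≠ i := fun k hk h => hi (h ▸ hk)
    obtain ⟨t, ht, hti⟩ := hΔ i (Finset.mem_insert_self i S)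
    have hfix : ∀ j ∈ S, shiftHom K i (σ j - Delta K j t) = σ j - Delta K j t := fun j hj => by
      rw [← Delta_eq_zero_iff, Delta_sub, Delta_comm, hti,
        hσ i (Finset.mem_insert_self i S) j (Finset.mem_insert_of_mem hj), sub_self]
    obtain ⟨u, hu, hui⟩ := ih (fun j => σ j - Delta K j t)
      (fun j hj => by
        obtain ⟨v, hv, hvj⟩ := hΔ j (Finset.mem_insert_of_mem hj)
        -- The constant coefficient in 1/h̃_i is invariant under −ε_i and keeps the j-th difference,
        -- which is itself invariant by `hfix`.
        refine ⟨coef i 0 (v - t), fun k hk => shiftHom_coef_of_fixed (fun hki => ?_) 0, ?_⟩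
        · rw [map_sub, hv k (by simp [hki, hk]), ht k (by simp [hki, hk])]
        · rw [Delta_coef (hne j hj), Delta_sub, hvj, coef_of_shift_fixed (hfix j hj), if_pos rfl])
      (fun a ha b hb => by
        rw [Delta_sub, Delta_sub, hσ a (Finset.mem_insert_of_mem ha) b
          (Finset.mem_insert_of_mem hb), Delta_comm])
    refine ⟨t + u, fun k hk => ?_, fun j hj => ?_⟩
    · rw [map_add, ht k hk, hu k fun h => hk (Finset.mem_insert_of_mem h)]
    · rw [Delta_add]
      rcases Finset.mem_insert.1 hj with rfl | hj
      · rw [hti, Delta_eq_zero_iff.2 (hu j hi), add_zero]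
      · rw [hui j hj]; ring

end Main

end

/-! ### From the system to a potential -/

noncomputable section

variable {K : Type*} [CommRing K] {n : ℕ}

theorem hdiff_mul_Delta_Delta {i j : Fin n} (h : i ≠ j) (f : Ubar K n) :
    hdiff K i j * Delta K j (Delta K i f) - (Delta K i f - Delta K j f) =
      Delta K i (Delta K j ((hvar K i - hvar K j) * f)) := by
  simp only [hdiff_eq, Delta_eq, map_sub, map_mul, shiftHom_comm j i, shiftHom_hvar_self,
    shiftHom_hvar_of_ne h, shiftHom_hvar_of_ne h.symm, map_one]
  ring

theorem mk_chi_eq (k : Fin n) (p : Polynomial K) :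
    Localization.mk (Polynomial.aeval (MvPolynomial.X k : U K n) p) ⟨chi K k, chi_mem K k⟩ =
      Polynomial.aeval (hvar K k) p * hprod K k (Finset.univ.erase k) := by
  have h1 : algebraMap (U K n) (Ubar K n) (chi K k) =
      ∏ l ∈ Finset.univ.erase k, (hvar K k - hvar K l) := by
    simp [chi, hvar]
  rw [Localization.mk_eq_mk', IsLocalization.mk'_eq_iff_eq_mul, h1, mul_assoc,
    mul_comm (hprod _ _ _), prod_hvar_sub_mul_hprod (Finset.notMem_erase _ _), mul_one, hvar,
    Polynomial.aeval_algebraMap_apply]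

theorem isPotential_of_mem_W {s : Ubar K n} (hs : s ∈ W K n) : IsPotential Finset.univ s := by
  refine Submodule.iSup_induction (Wpart K) (motive := IsPotential Finset.univ) hs ?_
    IsPotential.zero fun _ _ => IsPotential.add
  rintro k _ ⟨p, rfl⟩
  rw [mk_chi_eq]
  exact isPotential_aeval_mul_hprod k p

theorem aeval_mul_hprod_mem_W (k : Fin n) (p : Polynomial K) :
    Polynomial.aeval (hvar K k) p * hprod K k (Finset.univ.erase k) ∈ W K n :=
  Submodule.mem_iSup_of_mem k ⟨p, (mk_chi_eq k p).symm⟩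

variable [Algebra ℚ K]

open Polynomial in
theorem exists_antidifference (p : K[X]) : ∃ q : K[X], q - q.comp (X - 1) = p := by
  induction p using Polynomial.induction_on' with
  | add p q hp hq =>
    obtain ⟨P, hP⟩ := hp
    obtain ⟨Q, hQ⟩ := hq
    exact ⟨P + Q, by rw [add_comp, ← hP, ← hQ]; ring⟩
  | monomial m c =>
    -- B_{m+1}(X + 1) − B_{m+1}(X) = (m + 1) X^m; the argument 1 + X turns this into a backward
    -- difference.
    let b : ℚ[X] := C ((m + 1 : ℚ)⁻¹) * (Polynomial.bernoulli (m + 1)).comp (1 + X)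
    have hb : b - b.comp (X - 1) = X ^ m := by
      have hm : (C ((m + 1 : ℚ)⁻¹) : ℚ[X]) * C ((m : ℚ) + 1) = 1 := by
        rw [← C_mul, inv_mul_cancel₀ (by positivity), C_1]
      have h1 : ((1 : ℚ[X]) + X).comp (X - 1) = X := by simp
      simp only [b, mul_comp, C_comp, comp_assoc, h1, comp_X]
      rw [bernoulli_comp_one_add_X, nsmul_eq_mul, Nat.add_sub_cancel]
      push_cast
      rw [map_add, map_one, map_natCast] at hm
      linear_combination (X ^ m) * hm
    refine ⟨C c * b.map (algebraMap ℚ K), ?_⟩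
    have h2 := congrArg (Polynomial.map (algebraMap ℚ K)) hb
    simp only [Polynomial.map_sub, Polynomial.map_comp, Polynomial.map_pow, map_X,
      Polynomial.map_one] at h2
    rw [mul_comp, C_comp, ← mul_sub, h2, C_mul_X_pow_eq_monomial]

theorem exists_Delta_eq_aeval (i : Fin n) (p : Polynomial K) :
    ∃ t, Delta K i t = Polynomial.aeval (hvar K i) p := by
  obtain ⟨q, rfl⟩ := exists_antidifference p
  refine ⟨Polynomial.aeval (hvar K i) q, ?_⟩
  rw [Delta_eq, ← Polynomial.aeval_algHom_apply, map_sub, Polynomial.aeval_comp]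
  simp

theorem exists_potential_of_system {σ : Fin n → Ubar K n}
    (h : ∀ i j, hdiff K i j * Delta K j (σ i) = σ i - σ j) : ∃ t, ∀ i, σ i = Delta K i t := by
  obtain ⟨t, -, ht⟩ := exists_potential Finset.univ σ
    (fun i _ => by
      suffices H : ∃ t, Delta K i t = σ i by
        obtain ⟨t, ht⟩ := H
        exact ⟨t, by simp, ht⟩
      by_cases hi : ∃ j, j ≠ i
      · obtain ⟨j, hji⟩ := hi
        -- Translation by −ε_i sends 1 − h̃_ji to −h̃_ji, so the difference is σ_j − h̃_ji Δ_i σ_j,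
        -- which is σ_i.
        refine ⟨(1 - (hvar K j - hvar K i)) * σ j, ?_⟩
        have h1 := h j i
        simp only [hdiff_eq, Delta_eq] at h1
        simp only [Delta_eq, map_mul, map_sub, map_one, shiftHom_hvar_self,
          shiftHom_hvar_of_ne hji]
        linear_combination -h1
      · obtain ⟨p, hp⟩ := exists_polynomial_of_shift_fixed i (f := σ i)
          fun j hj => absurd ⟨j, hj⟩ hi
        rw [hp]
        exact exists_Delta_eq_aeval i p)
    (fun i _ j _ => by
      by_cases hij : i = j
      · rw [hij]
      have h1 := h i j
      have h2 := h j i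
      rw [hdiff_eq] at h1 h2
      refine (isUnit_hvar_sub (K := K) hij).mul_right_injective ?_
      beta_reduce
      linear_combination -h1 - h2)
  exact ⟨t, fun i => (ht i (Finset.mem_univ i)).symm⟩

end

end HDeformed

theorem proposition3p6 {K : Type*} [CommRing K] [Algebra ℚ K] (n : ℕ)
    (σ : Fin n → HDeformed.Ubar K n) :
    (∀ i j : Fin n, HDeformed.hdiff K i j * HDeformed.Delta K j (σ i) = σ i - σ j) ↔
      ∃ s ∈ HDeformed.W K n, ∀ i : Fin n, σ i = HDeformed.Delta K i s := by
  constructor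
  · intro h
    -- For n = 0 every scalar is a potential while 𝒲 = 0, so the sum formula is not available.
    rcases isEmpty_or_nonempty (Fin n) with hn | hn
    · exact ⟨0, Submodule.zero_mem _, fun i => hn.elim i⟩
    obtain ⟨s, hs⟩ := HDeformed.exists_potential_of_system h
    have hpot : HDeformed.IsPotential Finset.univ s := fun i _ j _ hij => by
      rw [← HDeformed.hdiff_mul_Delta_Delta hij, ← hs, ← hs, h i j, sub_self]
    obtain ⟨π, hπ⟩ := hpot.exists_eq_sum Finset.univ_nonempty (by simp)
    refine ⟨s, ?_, hs⟩
    rw [hπ]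
    exact Submodule.sum_mem _ fun k _ => HDeformed.aeval_mul_hprod_mem_W k (π k)
  · rintro ⟨s, hsW, hs⟩ i j
    by_cases hij : i = j
    · simp [hij, HDeformed.hdiff_eq]
    rw [hs i, hs j, ← sub_eq_zero, HDeformed.hdiff_mul_Delta_Delta hij]
    exact HDeformed.isPotential_of_mem_W hsW i (Finset.mem_univ i) j (Finset.mem_univ j) hij
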